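/- Let $\mathscr{A}$ be a non-empty set (the alphabet), and let $\mathsf{X}\subseteq \mathscr{A}^{\mathbb{N}}$ be a subshift: for some set $F$ of finite words over $\mathscr{A}$, $\mathsf{X}$ is the set of all sequences none of whose finite factors lies in $F$. Let $\mathcal{L}$ be the set of finite words (including the empty word $\omega$) that are initial segments of elements of $\mathsf{X}$, and assume that every letter of $\mathscr{A}$ belongs to $\mathcal{L}$. For $\alpha,\beta\in\mathcal{L}$ put $C(\alpha,\beta)=\{\beta x\in\mathsf{X}:\alpha x\in\mathsf{X}\}$, and let $\mathcal{U}$ be the Boolean algebra of subsets of $\mathsf{X}$ generated by all $C(\alpha,\beta)$ with $\alpha,\beta\in\mathcal{L}$. Let $R$ be a field, and let $\widetilde{\mathcal{A}}=\widetilde{\mathcal{A}}_R(\mathsf{X})$ be the universal unital $R$-algebra with generators $p_A$ ($A\in\mathcal{U}$) and $s_a,s_a^*$ ($a\in\mathscr{A}$), subject to the relations 1. $p_{\mathsf{X}}=1$, $p_\emptyset=0$, $p_{A\cap B}=p_Ap_B$ and $p_{A\cup B}=p_A+p_B-p_{A\cap B}$ for all $A,B\in\mathcal{U}$; 2. $s_as_a^*s_a=s_a$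 and $s_a^*s_as_a^*=s_a^*$ for all $a\in\mathscr{A}$; 3. $s_\beta s_\alpha^*s_\alpha s_\beta^*=p_{C(\alpha,\beta)}$ for all $\alpha,\beta\in\mathcal{L}$, where $s_\omega=s_\omega^*=1$ and, for $\alpha=\alpha_1\cdots\alpha_n$, $s_\alpha=s_{\alpha_1}\cdots s_{\alpha_n}$ and $s_\alpha^*=s_{\alpha_n}^*\cdots s_{\alpha_1}^*$. Let $\mathcal{Q}_{\mathsf{X}}$ be the set of all one-point sets $\{q\}\in\mathcal{U}$ such that $q\neq\alpha\beta^\infty$ for all $\alpha,\beta\in\mathcal{L}$ with $\beta\neq\omega$, where $\beta^\infty=\beta\beta\beta\cdots$ (that is, $q$ is not eventually periodic). Then, for every $A\in\mathcal{U}$: (a) the left ideal $\widetilde{\mathcal{A}}\,p_A$ is a minimal left ideal (that is, it is nonzero and contains no left ideal of $\widetilde{\mathcal{A}}$ other than $0$ and itself) if and only if $A\in\mathcal{Q}_{\mathsf{X}}$; (b) if $A\in\mathcal{Q}_{\mathsf{X}}$, then $p_A\widetilde{\mathcal{A}}\,p_A=R\,p_A$. -/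

import Mathlib

namespace SubshiftAlg

/-- Infinite words over the alphabet `𝓐` are `Stream' 𝓐` (that is, functions `ℕ → 𝓐`); finite words
are lists. The concatenation `α x` is `α ++ₛ x`, and `β^∞` is `Stream'.cycle β _` for `β ≠ []`.
The subshift `X_F` of all sequences none of whose finite factors lies in `F`. -/
def subshift {𝓐 : Type*} (F : Set (List 𝓐)) : Set (Stream' 𝓐) :=
  {x | ∀ n k : ℕ, (x.drop n).take k ∉ F}

/-- `X` is a subshift: it is defined by some set of forbidden finite words. -/
def IsSubshift {𝓐 : Type*} (X : Set (Stream' 𝓐)) : Prop :=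
  ∃ F : Set (List 𝓐), X = subshift F

/-- The language of `X`: all words `a₀ … aₙ₋₁` with `a₀ … aₙ₋₁ = x₀ … xₙ₋₁` for some `x ∈ X`. -/
def language {𝓐 : Type*} (X : Set (Stream' 𝓐)) : Set (List 𝓐) :=
  {w | ∃ x ∈ X, x.take w.length = w}

/-- `C(α, β) = {β x ∈ X : α x ∈ X}`, as a subset of `X`. -/
def cset {𝓐 : Type*} (X : Set (Stream' 𝓐)) (α β : List 𝓐) : Set X :=
  {z | ∃ x : Stream' 𝓐, (z : Stream' 𝓐) = β ++ₛ x ∧ α ++ₛ x ∈ X}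

/-- The Boolean algebra of subsets of `X` generated by the sets `C(α, β)`, `α, β` in the language. -/
def boolAlg {𝓐 : Type*} (X : Set (Stream' 𝓐)) : BooleanSubalgebra (Set X) :=
  BooleanSubalgebra.closure {B | ∃ α ∈ language X, ∃ β ∈ language X, B = cset X α β}

/-- `C(α, β)` as an element of the Boolean algebra. -/
def csetU {𝓐 : Type*} (X : Set (Stream' 𝓐)) (α β : List 𝓐)
    (hα : α ∈ language X) (hβ : β ∈ language X) : boolAlg X :=
  ⟨cset X α β, BooleanSubalgebra.subset_closure ⟨α, hα, β, hβ, rfl⟩⟩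

/-- The generators `p_A`, `s_a`, `s_a^*` of the unital subshift algebra. -/
inductive Gen {𝓐 : Type*} (X : Set (Stream' 𝓐))
  | p (A : boolAlg X)
  | s (a : 𝓐)
  | sStar (a : 𝓐)

section Free

variable (R : Type*) [CommRing R] {𝓐 : Type*} (X : Set (Stream' 𝓐))

/-- `p_A` in the free algebra. -/
def fp (A : boolAlg X) : FreeAlgebra R (Gen X) := FreeAlgebra.ι R (Gen.p A)

/-- `s_a` in the free algebra. -/
def fs (a : 𝓐) : FreeAlgebra R (Gen X) := FreeAlgebra.ι R (Gen.s a)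

/-- `s_a^*` in the free algebra. -/
def fsStar (a : 𝓐) : FreeAlgebra R (Gen X) := FreeAlgebra.ι R (Gen.sStar a)

/-- `s_α = s_{α₁} ⋯ s_{αₙ}`, with `s_ω = 1`. -/
def fsWord (α : List 𝓐) : FreeAlgebra R (Gen X) := (α.map (fs R X)).prod

/-- `s_α^* = s_{αₙ}^* ⋯ s_{α₁}^*`, with `s_ω^* = 1`. -/
def fsStarWord (α : List 𝓐) : FreeAlgebra R (Gen X) := (α.reverse.map (fsStar R X)).prod

/-- The defining relations of the unital subshift algebra. -/
inductive Rel : FreeAlgebra R (Gen X) → FreeAlgebra R (Gen X) → Prop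
  | p_univ : Rel (fp R X ⊤) 1
  | p_inter (A B : boolAlg X) : Rel (fp R X (A ⊓ B)) (fp R X A * fp R X B)
  | p_union (A B : boolAlg X) :
      Rel (fp R X (A ⊔ B)) (fp R X A + fp R X B - fp R X (A ⊓ B))
  | p_empty : Rel (fp R X ⊥) 0
  | s_sStar_s (a : 𝓐) : Rel (fs R X a * fsStar R X a * fs R X a) (fs R X a)
  | sStar_s_sStar (a : 𝓐) : Rel (fsStar R X a * fs R X a * fsStar R X a) (fsStar R X a)
  | word (α β : List 𝓐) (hα : α ∈ language X) (hβ : β ∈ language X) :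
      Rel (fsWord R X β * fsStarWord R X α * fsWord R X α * fsStarWord R X β)
        (fp R X (csetU X α β hα hβ))

/-- The unital subshift algebra: the universal unital `R`-algebra on the generators `Gen X`
subject to the relations `Rel R X`. -/
abbrev SubshiftAlgebra : Type _ := RingQuot (Rel R X)

/-- The element `p_A` of the unital subshift algebra. -/
def p (A : boolAlg X) : SubshiftAlgebra R X := RingQuot.mkAlgHom R (Rel R X) (fp R X A)

end Free

/-- The irrational paths: one-point sets `{q}` belonging to the Boolean algebra such that
`q ≠ α β^∞` for all `α, β` in the language (`β` non-empty, so that `β^∞` is an infinite word). -/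
def irrationalPaths {𝓐 : Type*} (X : Set (Stream' 𝓐)) : Set (Set X) :=
  {A | A ∈ boolAlg X ∧ ∃ q : X, A = {q} ∧
    ∀ α ∈ language X, ∀ β ∈ language X, ∀ hβ : β ≠ [],
      (q : Stream' 𝓐) ≠ α ++ₛ Stream'.cycle β hβ}

end SubshiftAlg

/-! Suppose `A = {q}` with `q` irrational. For `q = βq'` and `z = αq' ∈ X`, the element `s_α p_{q'}
s_β^*` behaves like a matrix unit from `q` to `z`. Each generator sends such a translate to another
one or to zero, so translates span the left ideal of `p_A` (`mul_mem_span_translates`). As `q` is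
not eventually periodic, a translate depends only on `z` (`IsTranslate.unique`). The reverse unit
`s_β p_{q'} s_α^*` brings it back to `p_A` and kills those ending elsewhere
(`exists_separating_mul`). Hence a nonzero element of the ideal can be multiplied on the left into a
nonzero multiple of `p_A`, and over a field this gives minimality. Multiplying by `p_A` on the left
keeps only the translate ending at `q`, which is `p_A` itself; this is (b).

Conversely, let the ideal be minimal. Two points of `A` would be separated by a cylinder, cutting
out a smaller nonzero ideal (`eq_of_isAtom_span_p`). If `A = {αβ^∞}`, then `w = s_α s_β s_α^*` loops
at the point, and `p_A - p_A w p_A` generates a proper nonzero subideal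
(`not_isAtom_span_p_of_periodic`). Nonvanishing is tested in a representation on functions on `X ×
ℤ`, where the integer records word length. -/

namespace SubshiftAlg

/-! ### Words, the shift, and the Boolean algebra -/

section Words

variable {𝓐 : Type*}

theorem exists_append_of_append_eq {α β : List 𝓐} {x y : Stream' 𝓐}
    (h : α ++ₛ x = β ++ₛ y) (hl : α.length ≤ β.length) :
    ∃ w, β = α ++ w ∧ x = w ++ₛ y := by
  induction α generalizing β with
  | nil => exact ⟨β, rfl, by simpa using h⟩
  | cons a α ih =>
    cases β with
    | nil => simp at hl
    | cons b β =>
      rw [Stream'.cons_append_stream, Stream'.cons_append_stream] at h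
      obtain ⟨rfl, h1⟩ := Stream'.cons_injective2 h
      obtain ⟨w, rfl, hw⟩ := ih h1 (by simpa using hl)
      exact ⟨w, rfl, hw⟩

theorem eq_cycle_of_eq_append {w : List 𝓐} (hw : w ≠ []) {x : Stream' 𝓐}
    (h : x = w ++ₛ x) : x = Stream'.cycle w hw := by
  have key : ∀ n, x.get n = (Stream'.cycle w hw).get n := by
    intro n
    induction n using Nat.strong_induction_on with
    | _ n ih =>
      rw [h, Stream'.cycle_eq]
      by_cases hn : n < w.length
      · rw [Stream'.get_append_left _ _ _ hn, Stream'.get_append_left _ _ _ hn]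
      · obtain ⟨m, rfl⟩ := Nat.exists_eq_add_of_le (not_lt.mp hn)
        rw [Stream'.get_append_right, Stream'.get_append_right]
        exact ih m (by have := List.length_pos_of_ne_nil hw; omega)
  exact Stream'.ext key

theorem take_length_append (w : List 𝓐) (y : Stream' 𝓐) : (w ++ₛ y).take w.length = w := by
  rw [Stream'.take_append_of_le_length _ _ _ le_rfl, List.take_length]

variable {X : Set (Stream' 𝓐)}

theorem mem_language_iff {w : List 𝓐} : w ∈ language X ↔ ∃ y, w ++ₛ y ∈ X := by
  constructor
  · rintro ⟨x, hx, hw⟩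
    refine ⟨x.drop w.length, ?_⟩
    nth_rewrite 1 [← hw]
    rwa [Stream'.append_take_drop]
  · rintro ⟨y, hy⟩
    exact ⟨_, hy, take_length_append w y⟩

/-- Factors of a tail are factors of the whole sequence. This shift invariance is all that the proof
uses of being a subshift. -/
theorem IsSubshift.mem_of_append_mem (hX : IsSubshift X) {w : List 𝓐} {x : Stream' 𝓐}
    (h : w ++ₛ x ∈ X) : x ∈ X := by
  obtain ⟨F, rfl⟩ := hX
  intro n k
  have := h (w.length + n) k
  rwa [← Stream'.drop_drop, Stream'.drop_append_stream] at this

theorem IsSubshift.mem_of_cons_mem (hX : IsSubshift X) {a : 𝓐} {x : Stream' 𝓐}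
    (h : Stream'.cons a x ∈ X) : x ∈ X :=
  hX.mem_of_append_mem (w := [a]) h

theorem IsSubshift.right_mem_language (hX : IsSubshift X) {v w : List 𝓐}
    (h : v ++ w ∈ language X) : w ∈ language X := by
  obtain ⟨y, hy⟩ := mem_language_iff.mp h
  rw [Stream'.append_append_stream] at hy
  exact mem_language_iff.mpr ⟨y, hX.mem_of_append_mem hy⟩

theorem mem_language_of_append_mem {w : List 𝓐} {y : Stream' 𝓐} (h : w ++ₛ y ∈ X) :
    w ∈ language X :=
  mem_language_iff.mpr ⟨y, h⟩

/-- Membership of an arbitrary sequence in an element of the Boolean algebra. -/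
def Mem (x : Stream' 𝓐) (B : boolAlg X) : Prop := ∃ h : x ∈ X, (⟨x, h⟩ : X) ∈ (B : Set X)

theorem Mem.mem {x : Stream' 𝓐} {B : boolAlg X} (h : Mem x B) : x ∈ X := h.1

theorem boolAlg_ext {B C : boolAlg X} (h : ∀ x ∈ X, Mem x B ↔ Mem x C) : B = C := by
  apply Subtype.ext
  ext ⟨x, hx⟩
  simpa [Mem, hx] using h x hx

theorem mem_inf {x : Stream' 𝓐} {B C : boolAlg X} : Mem x (B ⊓ C) ↔ Mem x B ∧ Mem x C := by
  constructor
  · rintro ⟨h, h1, h2⟩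
    exact ⟨⟨h, h1⟩, ⟨h, h2⟩⟩
  · rintro ⟨⟨h, h1⟩, ⟨_, h2⟩⟩
    exact ⟨h, h1, h2⟩

theorem mem_sup {x : Stream' 𝓐} {B C : boolAlg X} : Mem x (B ⊔ C) ↔ Mem x B ∨ Mem x C := by
  constructor
  · rintro ⟨h, h1 | h1⟩
    exacts [Or.inl ⟨h, h1⟩, Or.inr ⟨h, h1⟩]
  · rintro (⟨h, h1⟩ | ⟨h, h1⟩)
    exacts [⟨h, Or.inl h1⟩, ⟨h, Or.inr h1⟩]

theorem mem_compl {x : Stream' 𝓐} {B : boolAlg X} : Mem x Bᶜ ↔ x ∈ X ∧ ¬ Mem x B := by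
  constructor
  · rintro ⟨h, h1⟩
    exact ⟨h, fun ⟨_, h2⟩ => h1 h2⟩
  · rintro ⟨h, h1⟩
    exact ⟨h, fun h2 => h1 ⟨h, h2⟩⟩

theorem mem_top {x : Stream' 𝓐} : Mem x (⊤ : boolAlg X) ↔ x ∈ X :=
  ⟨fun h => h.1, fun h => ⟨h, trivial⟩⟩

theorem not_mem_bot {x : Stream' 𝓐} : ¬ Mem x (⊥ : boolAlg X) := fun h => h.2

theorem mem_csetU {x : Stream' 𝓐} {α β : List 𝓐} {hα : α ∈ language X} {hβ : β ∈ language X} :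
    Mem x (csetU X α β hα hβ) ↔ x ∈ X ∧ ∃ y, x = β ++ₛ y ∧ α ++ₛ y ∈ X :=
  ⟨fun ⟨h, h1⟩ => ⟨h, h1⟩, fun ⟨h, h1⟩ => ⟨h, h1⟩⟩

/-- Induction over the Boolean algebra generated by the sets `C(α, β)`. -/
theorem boolAlg_induction {P : boolAlg X → Prop}
    (gen : ∀ α β (hα : α ∈ language X) (hβ : β ∈ language X), P (csetU X α β hα hβ))
    (bot : P ⊥) (sup : ∀ B C, P B → P C → P (B ⊔ C)) (compl : ∀ B, P B → P Bᶜ)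
    (B : boolAlg X) : P B := by
  obtain ⟨B, hB⟩ := B
  refine BooleanSubalgebra.closure_bot_sup_induction (p := fun B hB => P ⟨B, hB⟩)
    ?_ bot ?_ ?_ hB
  · rintro _ ⟨α, hα, β, hβ, rfl⟩
    exact gen α β hα hβ
  · intro B hB C hC h1 h2
    exact sup _ _ h1 h2
  · intro B hB h
    exact compl _ h

end Words

end SubshiftAlg

namespace SubshiftAlg

/-! ### Relations and induction in the presented algebra -/

section Presentation

variable (R : Type*) [CommRing R] {𝓐 : Type*} (X : Set (Stream' 𝓐))

/-- `s_a` in the subshift algebra. -/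
def s (a : 𝓐) : SubshiftAlgebra R X := RingQuot.mkAlgHom R (Rel R X) (fs R X a)

/-- `s_a^*` in the subshift algebra. -/
def sStar (a : 𝓐) : SubshiftAlgebra R X := RingQuot.mkAlgHom R (Rel R X) (fsStar R X a)

/-- `s_α` in the subshift algebra. -/
def sWord (α : List 𝓐) : SubshiftAlgebra R X := (α.map (s R X)).prod

/-- `s_α^*` in the subshift algebra. -/
def sStarWord (α : List 𝓐) : SubshiftAlgebra R X := (α.reverse.map (sStar R X)).prod

@[simp] theorem sWord_nil : sWord R X [] = 1 := rfl

@[simp] theorem sStarWord_nil : sStarWord R X [] = 1 := rfl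

theorem sWord_cons (a : 𝓐) (α : List 𝓐) : sWord R X (a :: α) = s R X a * sWord R X α := by
  simp [sWord]

theorem sStarWord_cons (a : 𝓐) (α : List 𝓐) :
    sStarWord R X (a :: α) = sStarWord R X α * sStar R X a := by
  simp [sStarWord]

theorem sWord_append (α β : List 𝓐) : sWord R X (α ++ β) = sWord R X α * sWord R X β := by
  simp [sWord]

theorem sStarWord_append (α β : List 𝓐) :
    sStarWord R X (α ++ β) = sStarWord R X β * sStarWord R X α := by
  simp [sStarWord]

theorem mk_fsWord (α : List 𝓐) :
    RingQuot.mkAlgHom R (Rel R X) (fsWord R X α) = sWord R X α := by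
  rw [fsWord, map_list_prod, List.map_map]; rfl

theorem mk_fsStarWord (α : List 𝓐) :
    RingQuot.mkAlgHom R (Rel R X) (fsStarWord R X α) = sStarWord R X α := by
  rw [fsStarWord, map_list_prod, List.map_map]; rfl

theorem p_top : p R X ⊤ = 1 := by
  rw [p, RingQuot.mkAlgHom_rel R (Rel.p_univ), map_one]

theorem p_bot : p R X ⊥ = 0 := by
  rw [p, RingQuot.mkAlgHom_rel R (Rel.p_empty), map_zero]

theorem p_inf (A B : boolAlg X) : p R X (A ⊓ B) = p R X A * p R X B := by
  rw [p, RingQuot.mkAlgHom_rel R (Rel.p_inter A B), map_mul]; rfl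

theorem p_sup (A B : boolAlg X) :
    p R X (A ⊔ B) = p R X A + p R X B - p R X A * p R X B := by
  rw [← p_inf, p, RingQuot.mkAlgHom_rel R (Rel.p_union A B), map_sub, map_add]; rfl

theorem p_compl (A : boolAlg X) : p R X Aᶜ = 1 - p R X A := by
  have h := p_sup R X A Aᶜ
  rw [← p_inf, sup_compl_eq_top, inf_compl_eq_bot, p_top, p_bot, sub_zero] at h
  rw [h, add_sub_cancel_left]

theorem p_comm (A B : boolAlg X) : p R X A * p R X B = p R X B * p R X A := by
  rw [← p_inf, ← p_inf, inf_comm]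

theorem p_mul_self (A : boolAlg X) : p R X A * p R X A = p R X A := by
  rw [← p_inf, inf_idem]

theorem s_sStar_s (a : 𝓐) : s R X a * sStar R X a * s R X a = s R X a := by
  have h := RingQuot.mkAlgHom_rel R (Rel.s_sStar_s (R := R) (X := X) a)
  rw [map_mul, map_mul] at h; exact h

theorem sStar_s_sStar (a : 𝓐) : sStar R X a * s R X a * sStar R X a = sStar R X a := by
  have h := RingQuot.mkAlgHom_rel R (Rel.sStar_s_sStar (R := R) (X := X) a)
  rw [map_mul, map_mul] at h; exact h

theorem word_rel (α β : List 𝓐) (hα : α ∈ language X) (hβ : β ∈ language X) :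
    sWord R X β * sStarWord R X α * sWord R X α * sStarWord R X β =
      p R X (csetU X α β hα hβ) := by
  have h := RingQuot.mkAlgHom_rel R (Rel.word (R := R) (X := X) α β hα hβ)
  rw [map_mul, map_mul, map_mul] at h
  simp only [mk_fsWord, mk_fsStarWord] at h
  exact h

/-- An induction principle: the algebra is generated by the `p_A`, `s_a` and `s_a^*`. -/
theorem algebra_induction {P : SubshiftAlgebra R X → Prop}
    (hp : ∀ B, P (p R X B)) (hs : ∀ a, P (s R X a)) (hsStar : ∀ a, P (sStar R X a))
    (scalar : ∀ r : R, P (algebraMap R _ r)) (add : ∀ x y, P x → P y → P (x + y))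
    (mul : ∀ x y, P x → P y → P (x * y)) (x : SubshiftAlgebra R X) : P x := by
  obtain ⟨x, rfl⟩ := RingQuot.mkAlgHom_surjective R (Rel R X) x
  induction x using FreeAlgebra.induction with
  | grade0 r => rw [AlgHom.commutes]; exact scalar r
  | grade1 g =>
    cases g with
    | p B => exact hp B
    | s a => exact hs a
    | sStar a => exact hsStar a
  | mul x y hx hy => rw [map_mul]; exact mul _ _ hx hy
  | add x y hx hy => rw [map_add]; exact add _ _ hx hy

end Presentation

/-! ### The representation on functions on `X × ℤ` -/

section Representation

open Classical in
/-- Extension by zero of a function on `X × ℤ`. -/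
noncomputable def extend {R 𝓐 : Type*} [CommRing R] {X : Set (Stream' 𝓐)} (f : X → ℤ → R)
    (x : Stream' 𝓐) (n : ℤ) : R :=
  if h : x ∈ X then f ⟨x, h⟩ n else 0

variable {R 𝓐 : Type*} [CommRing R] {X : Set (Stream' 𝓐)}

theorem extend_of_mem {f : X → ℤ → R} {x : Stream' 𝓐} (h : x ∈ X) (n : ℤ) :
    extend f x n = f ⟨x, h⟩ n := dif_pos h

theorem extend_of_notMem {f : X → ℤ → R} {x : Stream' 𝓐} (h : x ∉ X) (n : ℤ) :
    extend f x n = 0 := dif_neg h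

theorem extend_add (f g : X → ℤ → R) (x : Stream' 𝓐) (n : ℤ) :
    extend (f + g) x n = extend f x n + extend g x n := by
  unfold extend; split <;> simp

theorem extend_sub (f g : X → ℤ → R) (x : Stream' 𝓐) (n : ℤ) :
    extend (f - g) x n = extend f x n - extend g x n := by
  unfold extend; split <;> simp

theorem extend_smul (r : R) (f : X → ℤ → R) (x : Stream' 𝓐) (n : ℤ) :
    extend (r • f) x n = r • extend f x n := by
  unfold extend; split <;> simp

theorem extend_zero (x : Stream' 𝓐) (n : ℤ) : extend (0 : X → ℤ → R) x n = 0 := by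
  unfold extend; split <;> simp

variable (R X)

open Classical in
/-- The operator of restriction to `A`. -/
noncomputable def opP (A : boolAlg X) : Module.End R (X → ℤ → R) where
  toFun f z n := if z ∈ (A : Set X) then f z n else 0
  map_add' f g := by ext z n; simp only [Pi.add_apply]; split <;> simp
  map_smul' r f := by ext z n; simp

open Classical in
/-- The operator of restriction to the cylinder of `a`, composed with the shift. -/
noncomputable def opS (a : 𝓐) : Module.End R (X → ℤ → R) where
  toFun f z n := if z.1.head = a then extend f z.1.tail (n - 1) else 0
  map_add' f g := by ext z n; simp only [Pi.add_apply, extend_add]; split <;> simp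
  map_smul' r f := by ext z n; simp [extend_smul]

/-- The operator of composition with the inverse branch of the shift given by `a`. -/
noncomputable def opSStar (a : 𝓐) : Module.End R (X → ℤ → R) where
  toFun f z n := extend f (Stream'.cons a z.1) (n + 1)
  map_add' f g := by ext z n; simp [extend_add]
  map_smul' r f := by ext z n; simp [extend_smul]

variable {R X}

open Classical in
theorem extend_opP (A : boolAlg X) (f : X → ℤ → R) (x : Stream' 𝓐) (n : ℤ) :
    extend (opP R X A f) x n = if Mem x A then extend f x n else 0 := by
  by_cases hx : x ∈ X
  · rw [extend_of_mem hx, extend_of_mem hx]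
    have : Mem x A ↔ (⟨x, hx⟩ : X) ∈ (A : Set X) := ⟨fun h => h.2, fun h => ⟨hx, h⟩⟩
    simp only [this]; rfl
  · rw [extend_of_notMem hx, if_neg fun h => hx h.1]

open Classical in
theorem extend_opS_cons (a b : 𝓐) (f : X → ℤ → R) (x : Stream' 𝓐) (n : ℤ) :
    extend (opS R X a f) (Stream'.cons b x) n =
      if b = a ∧ Stream'.cons b x ∈ X then extend f x (n - 1) else 0 := by
  by_cases hx : Stream'.cons b x ∈ X
  · simp only [extend_of_mem hx, hx, and_true]; rfl
  · rw [extend_of_notMem hx, if_neg fun h => hx h.2]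

open Classical in
theorem extend_opSStar (hX : IsSubshift X) (a : 𝓐) (f : X → ℤ → R) (x : Stream' 𝓐) (n : ℤ) :
    extend (opSStar R X a f) x n = extend f (Stream'.cons a x) (n + 1) := by
  by_cases hx : x ∈ X
  · rw [extend_of_mem hx]; rfl
  · rw [extend_of_notMem hx, extend_of_notMem fun h => hx (hX.mem_of_cons_mem h)]

theorem ext_of_extend {f g : X → ℤ → R} (h : ∀ x n, extend f x n = extend g x n) : f = g := by
  ext ⟨x, hx⟩ n
  simpa [extend_of_mem hx] using h x n

variable (R X)

/-- The representation on the generators. -/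
noncomputable def opGen : Gen X → Module.End R (X → ℤ → R)
  | .p A => opP R X A
  | .s a => opS R X a
  | .sStar a => opSStar R X a

/-- The representation of the free algebra. -/
noncomputable def opFree : FreeAlgebra R (Gen X) →ₐ[R] Module.End R (X → ℤ → R) :=
  FreeAlgebra.lift R (opGen R X)

@[simp] theorem opFree_fp (A : boolAlg X) : opFree R X (fp R X A) = opP R X A :=
  FreeAlgebra.lift_ι_apply _ _

@[simp] theorem opFree_fs (a : 𝓐) : opFree R X (fs R X a) = opS R X a :=
  FreeAlgebra.lift_ι_apply _ _

@[simp] theorem opFree_fsStar (a : 𝓐) : opFree R X (fsStar R X a) = opSStar R X a :=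
  FreeAlgebra.lift_ι_apply _ _

variable {R X}

theorem extend_opFree_fsStarWord (hX : IsSubshift X) (α : List 𝓐) (f : X → ℤ → R)
    (x : Stream' 𝓐) (n : ℤ) :
    extend (opFree R X (fsStarWord R X α) f) x n = extend f (α ++ₛ x) (n + α.length) := by
  induction α generalizing f with
  | nil => simp [fsStarWord]
  | cons a α ih =>
    have : fsStarWord R X (a :: α) = fsStarWord R X α * fsStar R X a := by simp [fsStarWord]
    rw [this, map_mul, Module.End.mul_apply, ih, opFree_fsStar, extend_opSStar hX,
      Stream'.cons_append_stream]
    congr 1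
    rw [List.length_cons]; push_cast; ring

open Classical in
theorem extend_opFree_fsWord (hX : IsSubshift X) (α : List 𝓐) (f : X → ℤ → R)
    (x : Stream' 𝓐) (n : ℤ) :
    extend (opFree R X (fsWord R X α) f) (α ++ₛ x) n =
      if α ++ₛ x ∈ X then extend f x (n - α.length) else 0 := by
  induction α generalizing n with
  | nil =>
    simp only [fsWord, List.map_nil, List.prod_nil, map_one, Module.End.one_apply,
      Stream'.nil_append_stream, List.length_nil, Nat.cast_zero, sub_zero]
    split_ifs with h
    exacts [rfl, extend_of_notMem h n]
  | cons a α ih =>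
    have : fsWord R X (a :: α) = fs R X a * fsWord R X α := by simp [fsWord]
    rw [this, map_mul, Module.End.mul_apply, opFree_fs, Stream'.cons_append_stream,
      extend_opS_cons, ih]
    by_cases h : Stream'.cons a (α ++ₛ x) ∈ X
    · rw [if_pos ⟨rfl, h⟩, if_pos h, if_pos (hX.mem_of_cons_mem h)]
      congr 1
      rw [List.length_cons]; push_cast; ring
    · rw [if_neg fun h' => h h'.2, if_neg h]

theorem extend_opFree_fsWord_of_ne (α : List 𝓐) (f : X → ℤ → R)
    (z : Stream' 𝓐) (n : ℤ) (h : ∀ x, z ≠ α ++ₛ x) :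
    extend (opFree R X (fsWord R X α) f) z n = 0 := by
  induction α generalizing n z with
  | nil => exact absurd rfl (h z)
  | cons a α ih =>
    have : fsWord R X (a :: α) = fs R X a * fsWord R X α := by simp [fsWord]
    have hz : z = Stream'.cons z.head z.tail := (Stream'.eta z).symm
    rw [this, map_mul, Module.End.mul_apply, opFree_fs, hz, extend_opS_cons]
    split_ifs with h1
    · refine ih _ _ fun x hx => h x ?_
      rw [hz, h1.1, hx, Stream'.cons_append_stream]
    · rfl

/-- Extension by zero lets every relation be checked pointwise at arbitrary sequences. The degree
shifts of each `s` and its matching `s^*` cancel, so the integer coordinate is compatible with the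
relations. -/
theorem opFree_rel (hX : IsSubshift X) {x y : FreeAlgebra R (Gen X)} (h : Rel R X x y) :
    opFree R X x = opFree R X y := by
  classical
  refine LinearMap.ext fun f => ext_of_extend fun z n => ?_
  cases h with
  | p_univ =>
    rw [opFree_fp, map_one, extend_opP, Module.End.one_apply]
    by_cases hz : z ∈ X
    · rw [if_pos (mem_top.mpr hz)]
    · rw [extend_of_notMem hz, ite_self]
  | p_inter A B =>
    simp only [opFree_fp, map_mul, Module.End.mul_apply, extend_opP, mem_inf, ite_and]
  | p_union A B =>
    simp only [opFree_fp, map_sub, map_add, LinearMap.sub_apply, LinearMap.add_apply,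
      extend_sub, extend_add, extend_opP, mem_inf, mem_sup]
    by_cases h1 : Mem z A <;> by_cases h2 : Mem z B <;> simp [h1, h2]
  | p_empty =>
    rw [opFree_fp, map_zero, extend_opP, if_neg not_mem_bot, LinearMap.zero_apply, extend_zero]
  | s_sStar_s a =>
    simp only [map_mul, opFree_fs, opFree_fsStar, Module.End.mul_apply]
    obtain ⟨b, z, rfl⟩ : ∃ b y, z = Stream'.cons b y := ⟨z.head, z.tail, (Stream'.eta z).symm⟩
    simp only [extend_opS_cons, extend_opSStar hX, sub_add_cancel]
    by_cases h : b = a ∧ Stream'.cons b z ∈ X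
    · obtain ⟨rfl, h⟩ := h
      simp [h]
    · simp [h]
  | sStar_s_sStar a =>
    simp only [map_mul, opFree_fs, opFree_fsStar, Module.End.mul_apply]
    simp only [extend_opS_cons, extend_opSStar hX]
    by_cases h : Stream'.cons a z ∈ X
    · simp [h]
    · simp [h, extend_of_notMem]
  | word α β hα hβ =>
    simp only [map_mul, opFree_fp, Module.End.mul_apply]
    rw [extend_opP, mem_csetU]
    by_cases hz : ∃ x, z = β ++ₛ x
    · obtain ⟨x, rfl⟩ := hz
      simp only [extend_opFree_fsWord hX, extend_opFree_fsStarWord hX, sub_add_cancel,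
        add_sub_cancel_right, Stream'.append_right_inj, exists_eq_left', ite_and]
    · rw [extend_opFree_fsWord_of_ne _ _ _ _ (not_exists.mp hz), if_neg]
      rintro ⟨-, y, hy, -⟩
      exact hz ⟨y, hy⟩

/-- The representation of the subshift algebra on the functions on `X × ℤ`. -/
noncomputable def rep (hX : IsSubshift X) :
    SubshiftAlgebra R X →ₐ[R] Module.End R (X → ℤ → R) :=
  RingQuot.liftAlgHom R ⟨opFree R X, fun _ _ h => opFree_rel hX h⟩

theorem rep_p (hX : IsSubshift X) (A : boolAlg X) : rep (R := R) hX (p R X A) = opP R X A := by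
  rw [rep, p, RingQuot.liftAlgHom_mkAlgHom_apply, opFree_fp]

theorem rep_sWord (hX : IsSubshift X) (α : List 𝓐) :
    rep (R := R) hX (sWord R X α) = opFree R X (fsWord R X α) := by
  rw [← mk_fsWord, rep, RingQuot.liftAlgHom_mkAlgHom_apply]

theorem rep_sStarWord (hX : IsSubshift X) (α : List 𝓐) :
    rep (R := R) hX (sStarWord R X α) = opFree R X (fsStarWord R X α) := by
  rw [← mk_fsStarWord, rep, RingQuot.liftAlgHom_mkAlgHom_apply]

/-- The image of `p_A` in the representation sends the constant function `1` to a function with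
value `1` at `x`. -/
theorem p_ne_zero [Nontrivial R] (hX : IsSubshift X) {A : boolAlg X} {x : Stream' 𝓐}
    (h : Mem x A) : p R X A ≠ 0 := by
  intro h0
  have h1 := rep_p (R := R) hX A
  rw [h0, map_zero] at h1
  have h2 := extend_opP A (1 : X → ℤ → R) x 0
  rw [← h1, LinearMap.zero_apply, extend_zero, if_pos h, extend_of_mem h.1] at h2
  exact zero_ne_one h2

end Representation

end SubshiftAlg

namespace SubshiftAlg

/-! ### Moving projections past `s_a` and `s_a^*` -/

section Transfer

variable {R : Type*} [CommRing R] {𝓐 : Type*} {X : Set (Stream' 𝓐)}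

theorem nil_mem_language {x : Stream' 𝓐} (h : x ∈ X) : ([] : List 𝓐) ∈ language X :=
  mem_language_iff.mpr ⟨x, h⟩

theorem nil_mem_language_of_mem {w : List 𝓐} (h : w ∈ language X) :
    ([] : List 𝓐) ∈ language X :=
  let ⟨_, hx⟩ := mem_language_iff.mp h
  nil_mem_language hx

theorem sWord_singleton (a : 𝓐) : sWord R X [a] = s R X a := by simp [sWord]

theorem sStarWord_singleton (a : 𝓐) : sStarWord R X [a] = sStar R X a := by simp [sStarWord]

theorem sWord_mul_sStarWord {α : List 𝓐} (hnil : [] ∈ language X) (hα : α ∈ language X) :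
    sWord R X α * sStarWord R X α = p R X (csetU X [] α hnil hα) := by
  simpa using word_rel R X [] α hnil hα

theorem sStarWord_mul_sWord {α : List 𝓐} (hnil : [] ∈ language X) (hα : α ∈ language X) :
    sStarWord R X α * sWord R X α = p R X (csetU X α [] hα hnil) := by
  simpa using word_rel R X α [] hα hnil

theorem s_mul_sStar {a : 𝓐} (hnil : [] ∈ language X) (ha : [a] ∈ language X) :
    s R X a * sStar R X a = p R X (csetU X [] [a] hnil ha) := by
  rw [← sWord_mul_sStarWord hnil ha, sWord_singleton, sStarWord_singleton]

theorem sStar_mul_s {a : 𝓐} (hnil : [] ∈ language X) (ha : [a] ∈ language X) :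
    sStar R X a * s R X a = p R X (csetU X [a] [] ha hnil) := by
  rw [← sStarWord_mul_sWord hnil ha, sWord_singleton, sStarWord_singleton]

theorem IsSubshift.mem_range_csetU (hX : IsSubshift X) {x : Stream' 𝓐} {α : List 𝓐}
    {hnil : [] ∈ language X} {hα : α ∈ language X} :
    Mem x (csetU X [] α hnil hα) ↔ x ∈ X ∧ ∃ y, x = α ++ₛ y := by
  rw [mem_csetU]
  constructor
  · rintro ⟨h, y, hy, -⟩
    exact ⟨h, y, hy⟩
  · rintro ⟨h, y, rfl⟩
    exact ⟨h, y, rfl, hX.mem_of_append_mem h⟩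

theorem IsSubshift.mem_domain_csetU (hX : IsSubshift X) {x : Stream' 𝓐} {α : List 𝓐}
    {hnil : [] ∈ language X} {hα : α ∈ language X} :
    Mem x (csetU X α [] hα hnil) ↔ α ++ₛ x ∈ X := by
  rw [mem_csetU]
  constructor
  · rintro ⟨_, y, rfl, hy⟩
    exact hy
  · exact fun h => ⟨hX.mem_of_append_mem h, x, rfl, h⟩

/-- If no element of `B` starts with `a`, then `p_B s_a = 0`. -/
theorem IsSubshift.p_mul_s_eq_zero (hX : IsSubshift X) {a : 𝓐} (ha : [a] ∈ language X)
    {B : boolAlg X} (h : ∀ x, ¬ Mem (Stream'.cons a x) B) : p R X B * s R X a = 0 := by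
  have hnil := nil_mem_language_of_mem ha
  rw [← s_sStar_s, s_mul_sStar hnil ha, ← mul_assoc, ← p_inf]
  have : B ⊓ csetU X [] [a] hnil ha = ⊥ := by
    refine boolAlg_ext fun x _ => ⟨fun h1 => ?_, fun h1 => absurd h1 not_mem_bot⟩
    obtain ⟨h1, h2⟩ := mem_inf.mp h1
    obtain ⟨-, y, rfl⟩ := hX.mem_range_csetU.mp h2
    exact absurd h1 (h y)
  rw [this, p_bot, zero_mul]

/-- Induction on `B`. The preimage under `x ↦ ax` of `C(γ, ω)` is `C(γa, ω)`, and that of `C(γ, aδ)`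
is `C(γ, δ) ∩ C(a, ω)`; a generator containing no sequence `ax` gives zero. -/
theorem IsSubshift.exists_p_mul_s (hX : IsSubshift X)
    (hletters : ∀ a : 𝓐, [a] ∈ language X) (a : 𝓐) (B : boolAlg X) :
    ∃ B' : boolAlg X, (∀ x, Mem x B' ↔ Mem (Stream'.cons a x) B) ∧
      p R X B * s R X a = s R X a * p R X B' := by
  have ha := hletters a
  have hnil := nil_mem_language_of_mem ha
  -- Needed for complements: the preimage of `Bᶜ` is `B'ᶜ` cut down to those `x` with `ax ∈ X`, and
  -- `s_a` does not notice the cut.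
  have hF : s R X a * p R X (csetU X [a] [] ha hnil) = s R X a := by
    rw [← sStar_mul_s, ← mul_assoc, s_sStar_s]
  have hzero : ∀ B : boolAlg X, (∀ x, ¬ Mem (Stream'.cons a x) B) →
      ∃ B' : boolAlg X, (∀ x, Mem x B' ↔ Mem (Stream'.cons a x) B) ∧
      p R X B * s R X a = s R X a * p R X B' := fun B h =>
    ⟨⊥, fun x => ⟨fun h1 => absurd h1 not_mem_bot, fun h1 => absurd h1 (h x)⟩,
      by rw [p_bot, mul_zero, hX.p_mul_s_eq_zero ha h]⟩
  induction B using boolAlg_induction with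
  | gen γ δ hγ hδ =>
    cases δ with
    | nil =>
      by_cases hγa : γ ++ [a] ∈ language X
      · refine ⟨csetU X (γ ++ [a]) [] hγa hnil, fun x => ?_, ?_⟩
        · rw [hX.mem_domain_csetU, hX.mem_domain_csetU, Stream'.append_append_stream,
            Stream'.append_eq_cons]
        · rw [← sStarWord_mul_sWord hnil hγa, sWord_append, sStarWord_append,
            sWord_singleton, sStarWord_singleton]
          calc p R X (csetU X γ [] hγ hδ) * s R X a
              = p R X (csetU X γ [] hγ hδ) * (s R X a * sStar R X a) * s R X a := by
                rw [mul_assoc, s_sStar_s]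
            _ = s R X a * sStar R X a * p R X (csetU X γ [] hγ hδ) * s R X a := by
                rw [s_mul_sStar hnil ha, p_comm]
            _ = _ := by
                rw [← sStarWord_mul_sWord hnil hγ]
                simp only [mul_assoc]
      · refine hzero _ fun x hx => hγa ?_
        rw [hX.mem_domain_csetU] at hx
        refine mem_language_of_append_mem (y := x) ?_
        rwa [Stream'.append_append_stream, Stream'.append_eq_cons]
    | cons b δ =>
      by_cases hab : a = b
      · subst hab
        have hδ' : δ ∈ language X := hX.right_mem_language (v := [a]) hδ
        refine ⟨csetU X γ δ hγ hδ' ⊓ csetU X [a] [] ha hnil, fun x => ?_, ?_⟩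
        · rw [mem_inf, hX.mem_domain_csetU, mem_csetU, mem_csetU, Stream'.append_eq_cons]
          constructor
          · rintro ⟨⟨_, y, rfl, hy⟩, h⟩
            exact ⟨h, y, rfl, hy⟩
          · rintro ⟨h, y, hxy, hy⟩
            exact ⟨⟨hX.mem_of_cons_mem h, y, (Stream'.cons_injective2 hxy).2, hy⟩, h⟩
        · rw [← word_rel, p_inf, ← word_rel, ← sStar_mul_s, sWord_cons, sStarWord_cons]
          simp only [mul_assoc]
      · refine hzero _ fun x hx => hab ?_
        obtain ⟨_, y, hy, _⟩ := mem_csetU.mp hx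
        exact (Stream'.cons_injective2 hy).1
  | bot => exact hzero _ fun x => not_mem_bot
  | sup B C hB hC =>
    obtain ⟨B', h1, h2⟩ := hB
    obtain ⟨C', h3, h4⟩ := hC
    refine ⟨B' ⊔ C', fun x => by rw [mem_sup, mem_sup, h1, h3], ?_⟩
    rw [p_sup, p_sup, sub_mul, add_mul, mul_sub, mul_add, h2, h4, mul_assoc, h4, ← mul_assoc,
      h2, mul_assoc]
  | compl B hB =>
    obtain ⟨B', h1, h2⟩ := hB
    refine ⟨csetU X [a] [] ha hnil ⊓ B'ᶜ, fun x => ?_, ?_⟩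
    · rw [mem_inf, mem_compl, mem_compl, hX.mem_domain_csetU, h1, Stream'.append_eq_cons]
      exact ⟨fun h => ⟨h.1, h.2.2⟩, fun h => ⟨h.1, hX.mem_of_cons_mem h.1, h.2⟩⟩
    · rw [p_inf, ← mul_assoc, hF, p_compl, p_compl, sub_mul, mul_sub, h2, one_mul, mul_one]

/-- The identity for `s_a^*` follows from the one for `s_a`: insert `s_a s_a^*`, which commutes with
`p_B`, and absorb `s_a^* s_a` into `p_{B'}`, since `B'` lies in `C(a, ω)`. -/
theorem IsSubshift.exists_transfer (hX : IsSubshift X)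
    (hletters : ∀ a : 𝓐, [a] ∈ language X) (a : 𝓐) (B : boolAlg X) :
    ∃ B' : boolAlg X, (∀ x, Mem x B' ↔ Mem (Stream'.cons a x) B) ∧
      p R X B * s R X a = s R X a * p R X B' ∧
      sStar R X a * p R X B = p R X B' * sStar R X a := by
  have ha := hletters a
  have hnil := nil_mem_language_of_mem ha
  obtain ⟨B', h1, h2⟩ := hX.exists_p_mul_s (R := R) hletters a B
  refine ⟨B', h1, h2, ?_⟩
  have h3 : csetU X [a] [] ha hnil ⊓ B' = B' := by
    refine boolAlg_ext fun x _ => ?_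
    rw [mem_inf, hX.mem_domain_csetU]
    exact ⟨fun h => h.2, fun h => ⟨((h1 x).mp h).1, h⟩⟩
  calc sStar R X a * p R X B
      = sStar R X a * ((s R X a * sStar R X a) * p R X B) := by
        rw [← mul_assoc, ← mul_assoc, sStar_s_sStar]
    _ = sStar R X a * (p R X B * s R X a) * sStar R X a := by
        rw [s_mul_sStar hnil ha, p_comm, ← s_mul_sStar hnil ha]
        simp only [mul_assoc]
    _ = sStar R X a * s R X a * p R X B' * sStar R X a := by
        rw [h2]; simp only [mul_assoc]
    _ = p R X B' * sStar R X a := by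
        rw [sStar_mul_s hnil ha, ← p_inf, h3]

/-- For `B` in the Boolean algebra, the set `{x : αx ∈ B}` also belongs to it, and its projection
intertwines with that of `B` through `s_α` and `s_α^*`. -/
theorem IsSubshift.exists_transfer_word (hX : IsSubshift X)
    (hletters : ∀ a : 𝓐, [a] ∈ language X) (α : List 𝓐) (B : boolAlg X) :
    ∃ B' : boolAlg X, (∀ x, Mem x B' ↔ Mem (α ++ₛ x) B) ∧
      p R X B * sWord R X α = sWord R X α * p R X B' ∧
      sStarWord R X α * p R X B = p R X B' * sStarWord R X α := by
  induction α generalizing B with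
  | nil => exact ⟨B, fun x => Iff.rfl, by simp, by simp⟩
  | cons a α ih =>
    obtain ⟨B₁, h1, h2, h3⟩ := hX.exists_transfer (R := R) hletters a B
    obtain ⟨B₂, h4, h5, h6⟩ := ih B₁
    refine ⟨B₂, fun x => by rw [h4, h1, Stream'.cons_append_stream], ?_, ?_⟩
    · rw [sWord_cons, ← mul_assoc, h2, mul_assoc, h5, mul_assoc]
    · rw [sStarWord_cons, mul_assoc, h3, ← mul_assoc, h6, mul_assoc]

end Transfer

/-! ### Translates of a point projection, and minimality -/

section Translates

variable {𝓐 : Type*} {X : Set (Stream' 𝓐)}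

/-- `t` is a translate of `p_{q}` by a partial isometry `s_α s_β^*` carrying `q = β q'` to
`z = α q'`. -/
def IsTranslate (R : Type*) [CommRing R] (X : Set (Stream' 𝓐)) (q z : Stream' 𝓐)
    (t : SubshiftAlgebra R X) : Prop :=
  ∃ (α β : List 𝓐) (q' : Stream' 𝓐) (Q : boolAlg X), q = β ++ₛ q' ∧ z = α ++ₛ q' ∧ z ∈ X ∧
    (∀ x, Mem x Q ↔ x = q') ∧ t = sWord R X α * p R X Q * sStarWord R X β

variable {R : Type*} [CommRing R] {q z : Stream' 𝓐} {t : SubshiftAlgebra R X}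

theorem isTranslate_self {A : boolAlg X} (hA : ∀ x, Mem x A ↔ x = q) :
    IsTranslate R X q q (p R X A) :=
  ⟨[], [], q, A, rfl, rfl, ((hA q).mpr rfl).1, hA, by simp⟩

theorem inf_of_mem {q : Stream' 𝓐} {Q B : boolAlg X} (hQ : ∀ x, Mem x Q ↔ x = q)
    (h : Mem q B) : B ⊓ Q = Q := by
  refine boolAlg_ext fun x _ => ?_
  rw [mem_inf, hQ]
  exact ⟨fun h => h.2, fun h' => ⟨h' ▸ h, h'⟩⟩

theorem inf_of_not_mem {q : Stream' 𝓐} {Q B : boolAlg X} (hQ : ∀ x, Mem x Q ↔ x = q)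
    (h : ¬ Mem q B) : B ⊓ Q = ⊥ := by
  refine boolAlg_ext fun x _ => ⟨fun h1 => ?_, fun h1 => absurd h1 not_mem_bot⟩
  rw [mem_inf, hQ] at h1
  exact absurd (h1.2 ▸ h1.1) h

theorem IsTranslate.p_mul_of_mem (hX : IsSubshift X) (hletters : ∀ a : 𝓐, [a] ∈ language X)
    (h : IsTranslate R X q z t) {B : boolAlg X} (hB : Mem z B) : p R X B * t = t := by
  obtain ⟨α, β, q', Q, rfl, rfl, hz, hQ, rfl⟩ := h
  obtain ⟨B', h1, h2, -⟩ := hX.exists_transfer_word (R := R) hletters α B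
  rw [← mul_assoc, ← mul_assoc, h2, mul_assoc (sWord R X α), ← p_inf,
    inf_of_mem hQ ((h1 q').mpr hB)]

theorem IsTranslate.p_mul_of_not_mem (hX : IsSubshift X)
    (hletters : ∀ a : 𝓐, [a] ∈ language X)
    (h : IsTranslate R X q z t) {B : boolAlg X} (hB : ¬ Mem z B) : p R X B * t = 0 := by
  obtain ⟨α, β, q', Q, rfl, rfl, hz, hQ, rfl⟩ := h
  obtain ⟨B', h1, h2, -⟩ := hX.exists_transfer_word (R := R) hletters α B
  rw [← mul_assoc, ← mul_assoc, h2, mul_assoc (sWord R X α), ← p_inf,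
    inf_of_not_mem hQ (mt (h1 q').mp hB), p_bot, mul_zero, zero_mul]

theorem IsTranslate.s_mul (h : IsTranslate R X q z t) {a : 𝓐} (hz : Stream'.cons a z ∈ X) :
    IsTranslate R X q (Stream'.cons a z) (s R X a * t) := by
  obtain ⟨α, β, q', Q, hq, rfl, -, hQ, rfl⟩ := h
  exact ⟨a :: α, β, q', Q, hq, rfl, hz, hQ, by simp only [sWord_cons, mul_assoc]⟩

theorem IsTranslate.s_mul_eq_zero (hX : IsSubshift X) (hletters : ∀ a : 𝓐, [a] ∈ language X)
    (h : IsTranslate R X q z t) {a : 𝓐} (hz : Stream'.cons a z ∉ X) : s R X a * t = 0 := by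
  have ha := hletters a
  have hnil := nil_mem_language_of_mem ha
  rw [← s_sStar_s, mul_assoc (s R X a), sStar_mul_s hnil ha, mul_assoc,
    h.p_mul_of_not_mem hX hletters (fun hm => hz (hX.mem_domain_csetU (α := [a]).mp hm)), mul_zero]

theorem IsTranslate.sStar_mul_of_ne (hX : IsSubshift X) (hletters : ∀ a : 𝓐, [a] ∈ language X)
    {a b : 𝓐} (h : IsTranslate R X q (Stream'.cons b z) t) (hab : a ≠ b) :
    sStar R X a * t = 0 := by
  have ha := hletters a
  have hnil := nil_mem_language_of_mem ha
  rw [← sStar_s_sStar, mul_assoc (sStar R X a), s_mul_sStar hnil ha, mul_assoc,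
    h.p_mul_of_not_mem hX hletters, mul_zero]
  intro hm
  obtain ⟨-, y, hy⟩ := hX.mem_range_csetU.mp hm
  exact hab (Stream'.cons_injective2 hy).1.symm

/-- If `α` is nonempty, `s_a^*` cancels its first letter. If `α` is empty, `s_a^*` passes through
the projection and `β` grows to `βa`. -/
theorem IsTranslate.sStar_mul (hX : IsSubshift X) (hletters : ∀ a : 𝓐, [a] ∈ language X)
    {a : 𝓐} (h : IsTranslate R X q (Stream'.cons a z) t) :
    IsTranslate R X q z (sStar R X a * t) := by
  have ha := hletters a
  have hnil := nil_mem_language_of_mem ha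
  obtain ⟨α, β, q', Q, hq, hz, hmem, hQ, rfl⟩ := h
  have hzX := hX.mem_of_cons_mem hmem
  cases α with
  | nil =>
    obtain rfl : Stream'.cons a z = q' := hz
    obtain ⟨Q', h1, -, h3⟩ := hX.exists_transfer (R := R) hletters a Q
    refine ⟨[], β ++ [a], z, Q', ?_, rfl, hzX, fun x => ?_, ?_⟩
    · rw [hq, Stream'.append_append_stream, Stream'.append_eq_cons]
    · rw [h1, hQ]
      exact ⟨fun h => (Stream'.cons_injective2 h).2, fun h => h ▸ rfl⟩
    · rw [sWord_nil, one_mul, one_mul, ← mul_assoc, h3, sStarWord_append, sStarWord_singleton,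
        mul_assoc]
  | cons b α =>
    rw [Stream'.cons_append_stream] at hz
    obtain ⟨rfl, rfl⟩ := Stream'.cons_injective2 hz
    have ht : IsTranslate R X q (α ++ₛ q') (sWord R X α * p R X Q * sStarWord R X β) :=
      ⟨α, β, q', Q, hq, rfl, hzX, hQ, rfl⟩
    have : sStar R X a * (sWord R X (a :: α) * p R X Q * sStarWord R X β) =
        sWord R X α * p R X Q * sStarWord R X β := by
      rw [sWord_cons, mul_assoc (s R X a), mul_assoc (s R X a), ← mul_assoc,
        sStar_mul_s hnil ha]
      exact ht.p_mul_of_mem hX hletters (hX.mem_domain_csetU.mpr hmem)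
    rwa [this]

theorem IsTranslate.sWord_mul (hX : IsSubshift X) (h : IsTranslate R X q z t) {γ : List 𝓐}
    (hz : γ ++ₛ z ∈ X) : IsTranslate R X q (γ ++ₛ z) (sWord R X γ * t) := by
  induction γ with
  | nil => simpa using h
  | cons a γ ih =>
    rw [sWord_cons, mul_assoc]
    exact (ih (hX.mem_of_cons_mem hz)).s_mul hz

theorem IsTranslate.sStarWord_mul (hX : IsSubshift X)
    (hletters : ∀ a : 𝓐, [a] ∈ language X) {γ : List 𝓐}
    (h : IsTranslate R X q (γ ++ₛ z) t) : IsTranslate R X q z (sStarWord R X γ * t) := by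
  induction γ generalizing t with
  | nil => simpa using h
  | cons a γ ih =>
    rw [sStarWord_cons, mul_assoc]
    exact ih (h.sStar_mul hX hletters)

theorem IsTranslate.sStarWord_mul_eq_zero (hX : IsSubshift X)
    (hletters : ∀ a : 𝓐, [a] ∈ language X) {γ : List 𝓐}
    (h : IsTranslate R X q z t) (hz : ∀ y, z ≠ γ ++ₛ y) : sStarWord R X γ * t = 0 := by
  induction γ generalizing t z with
  | nil => exact absurd rfl (hz z)
  | cons a γ ih =>
    obtain ⟨b, y, rfl⟩ : ∃ b y, z = Stream'.cons b y := ⟨z.head, z.tail, (Stream'.eta z).symm⟩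
    rw [sStarWord_cons, mul_assoc]
    by_cases hab : a = b
    · subst hab
      exact ih (h.sStar_mul hX hletters) fun x hx => hz x (by rw [hx]; rfl)
    · rw [h.sStar_mul_of_ne hX hletters hab, mul_zero]

/-- A sequence of `X` that is not of the form `αβ^∞`. -/
def IsIrrational (X : Set (Stream' 𝓐)) (q : Stream' 𝓐) : Prop :=
  q ∈ X ∧ ∀ α ∈ language X, ∀ β ∈ language X, ∀ hβ : β ≠ [], q ≠ α ++ₛ Stream'.cycle β hβ

/-- A nonempty `w` would force `x = w^∞`, making `δx` eventually periodic. Aperiodicity enters the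
minimality argument only here. -/
theorem IsIrrational.eq_nil_of_eq_append (hX : IsSubshift X) {δ w : List 𝓐} {x : Stream' 𝓐}
    (hq : IsIrrational X (δ ++ₛ x)) (h : x = w ++ₛ x) : w = [] := by
  by_contra hw
  refine hq.2 δ (mem_language_of_append_mem hq.1) w ?_ hw (by rw [← eq_cycle_of_eq_append hw h])
  refine mem_language_of_append_mem (y := x) ?_
  rw [← h]
  exact hX.mem_of_append_mem hq.1

/-- This is why replacing `(α, β)` by `(αε, βε)` leaves a translate unchanged. -/
theorem sWord_mul_p_mul_sStarWord (hX : IsSubshift X) (hletters : ∀ a : 𝓐, [a] ∈ language X)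
    {ε : List 𝓐} {x : Stream' 𝓐} {Q Q' : boolAlg X} (hQ : ∀ y, Mem y Q ↔ y = ε ++ₛ x)
    (hQ' : ∀ y, Mem y Q' ↔ y = x) :
    sWord R X ε * p R X Q' * sStarWord R X ε = p R X Q := by
  have hmem : ε ++ₛ x ∈ X := ((hQ _).mpr rfl).1
  have hε : ε ∈ language X := mem_language_of_append_mem hmem
  have hnil := nil_mem_language hmem
  obtain ⟨Q'', h1, h2, -⟩ := hX.exists_transfer_word (R := R) hletters ε Q
  obtain rfl : Q'' = Q' :=
    boolAlg_ext fun y _ => by rw [h1, hQ, hQ', Stream'.append_right_inj]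
  rw [← h2, mul_assoc, sWord_mul_sStarWord hnil hε, p_comm, ← p_inf,
    inf_of_mem hQ (hX.mem_range_csetU.mpr ⟨hmem, x, rfl⟩)]

/-- The translates of the projection at an irrational `q` are determined by their endpoints. -/
theorem IsTranslate.unique (hX : IsSubshift X) (hletters : ∀ a : 𝓐, [a] ∈ language X)
    (hq : IsIrrational X q) {t₁ t₂ : SubshiftAlgebra R X} (h₁ : IsTranslate R X q z t₁)
    (h₂ : IsTranslate R X q z t₂) : t₁ = t₂ := by
  obtain ⟨α, β, q₁, Q₁, hq₁, hz₁, -, hQ₁, rfl⟩ := h₁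
  obtain ⟨γ, δ, q₂, Q₂, hq₂, hz₂, -, hQ₂, rfl⟩ := h₂
  wlog hle : β.length ≤ δ.length generalizing α β γ δ q₁ q₂ Q₁ Q₂
  · exact (this γ δ q₂ Q₂ hq₂ hz₂ hQ₂ α β q₁ Q₁ hq₁ hz₁ hQ₁ (le_of_not_ge hle)).symm
  obtain ⟨ε, rfl, rfl⟩ := exists_append_of_append_eq (hq₁.symm.trans hq₂) hle
  rw [hz₁, ← Stream'.append_append_stream] at hz₂
  rw [hq₂] at hq
  -- Both words followed by `q₂` give `z`; a difference in length would yield `q₂ = w q₂` with `w`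
  -- nonempty.
  obtain rfl : γ = α ++ ε := by
    rcases le_total (α ++ ε).length γ.length with hl | hl
    · obtain ⟨w, rfl, hw⟩ := exists_append_of_append_eq hz₂ hl
      rw [hq.eq_nil_of_eq_append hX hw, List.append_nil]
    · obtain ⟨w, h, hw⟩ := exists_append_of_append_eq hz₂.symm hl
      rw [h, hq.eq_nil_of_eq_append hX hw, List.append_nil]
  rw [← sWord_mul_p_mul_sStarWord hX hletters hQ₁ hQ₂, sWord_append, sStarWord_append]
  simp only [mul_assoc]

/-- Each generator maps a translate to a translate or to zero; sums, products and scalars then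
preserve the span. -/
theorem mul_mem_span_translates (hX : IsSubshift X) (hletters : ∀ a : 𝓐, [a] ∈ language X)
    (y : SubshiftAlgebra R X) :
    ∀ v ∈ Submodule.span R {t | ∃ z, IsTranslate R X q z t},
      y * v ∈ Submodule.span R {t | ∃ z, IsTranslate R X q z t} := by
  have key : ∀ y : SubshiftAlgebra R X,
      (∀ z t, IsTranslate R X q z t →
        y * t ∈ Submodule.span R {t | ∃ z, IsTranslate R X q z t}) →
      ∀ v ∈ Submodule.span R {t | ∃ z, IsTranslate R X q z t},
        y * v ∈ Submodule.span R {t | ∃ z, IsTranslate R X q z t} := by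
    intro y hy v hv
    induction hv using Submodule.span_induction with
    | mem t ht => exact hy _ t ht.choose_spec
    | zero => rw [mul_zero]; exact zero_mem _
    | add v w _ _ h1 h2 => rw [mul_add]; exact add_mem h1 h2
    | smul r v _ h => rw [mul_smul_comm]; exact Submodule.smul_mem _ r h
  induction y using algebra_induction with
  | hp B =>
    refine key _ fun z t h => ?_
    by_cases hB : Mem z B
    · rw [h.p_mul_of_mem hX hletters hB]; exact Submodule.subset_span ⟨z, h⟩
    · rw [h.p_mul_of_not_mem hX hletters hB]; exact zero_mem _
  | hs a =>
    refine key _ fun z t h => ?_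
    by_cases hz : Stream'.cons a z ∈ X
    · exact Submodule.subset_span ⟨_, h.s_mul hz⟩
    · rw [h.s_mul_eq_zero hX hletters hz]; exact zero_mem _
  | hsStar a =>
    refine key _ fun z t h => ?_
    obtain ⟨b, y, rfl⟩ : ∃ b y, z = Stream'.cons b y := ⟨z.head, z.tail, (Stream'.eta z).symm⟩
    by_cases hab : a = b
    · subst hab
      exact Submodule.subset_span ⟨_, h.sStar_mul hX hletters⟩
    · rw [h.sStar_mul_of_ne hX hletters hab]; exact zero_mem _
  | scalar r =>
    intro v hv
    rw [← Algebra.smul_def]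
    exact Submodule.smul_mem _ r hv
  | add x y hx hy => intro v hv; rw [add_mul]; exact add_mem (hx v hv) (hy v hv)
  | mul x y hx hy => intro v hv; rw [mul_assoc]; exact hx _ (hy v hv)

theorem mul_p_mem_span_translates (hX : IsSubshift X) (hletters : ∀ a : 𝓐, [a] ∈ language X)
    {A : boolAlg X} (hA : ∀ x, Mem x A ↔ x = q) (y : SubshiftAlgebra R X) :
    y * p R X A ∈ Submodule.span R {t | ∃ z, IsTranslate R X q z t} :=
  mul_mem_span_translates hX hletters y _ (Submodule.subset_span ⟨q, isTranslate_self hA⟩)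

theorem exists_separating_mul (hX : IsSubshift X) (hletters : ∀ a : 𝓐, [a] ∈ language X)
    (hq : IsIrrational X q) {A : boolAlg X} (hA : ∀ x, Mem x A ↔ x = q)
    (h : IsTranslate R X q z t) :
    ∃ y : SubshiftAlgebra R X, y * t = p R X A ∧
      ∀ z' t', IsTranslate R X q z' t' → z' ≠ z → y * t' = 0 := by
  have h0 := h
  obtain ⟨α, β, q', Q, hqβ, hz, -, hQ, -⟩ := h0
  -- The reverse matrix unit, carrying `z = αq'` back to `q = βq'`.
  refine ⟨sWord R X β * p R X Q * sStarWord R X α, ?_, fun z' t' h' hne => ?_⟩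
  · rw [hz] at h
    have h1 := h.sStarWord_mul hX hletters
    rw [mul_assoc, mul_assoc, h1.p_mul_of_mem hX hletters ((hQ q').mpr rfl)]
    have h2 := h1.sWord_mul hX (γ := β) (hqβ ▸ hq.1)
    rw [← hqβ] at h2
    exact h2.unique hX hletters hq (isTranslate_self hA)
  · rw [mul_assoc, mul_assoc]
    by_cases hz' : ∃ y, z' = α ++ₛ y
    · obtain ⟨y, rfl⟩ := hz'
      rw [(h'.sStarWord_mul hX hletters).p_mul_of_not_mem hX hletters, mul_zero]
      intro hy
      rw [hQ] at hy
      exact hne (by rw [hy, hz])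
    · rw [h'.sStarWord_mul_eq_zero hX hletters (not_exists.mp hz'), mul_zero, mul_zero]

theorem p_mul_mul_p_mem_span (hX : IsSubshift X) (hletters : ∀ a : 𝓐, [a] ∈ language X)
    (hq : IsIrrational X q) {A : boolAlg X} (hA : ∀ x, Mem x A ↔ x = q)
    (x : SubshiftAlgebra R X) :
    p R X A * x * p R X A ∈ Submodule.span R {p R X A} := by
  rw [mul_assoc]
  have hmem := mul_p_mem_span_translates hX hletters hA x
  generalize x * p R X A = v at hmem
  induction hmem using Submodule.span_induction with
  | mem t ht =>
    obtain ⟨z, ht⟩ := ht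
    by_cases hz : z = q
    · subst hz
      rw [ht.p_mul_of_mem hX hletters ((hA z).mpr rfl),
        ht.unique hX hletters hq (isTranslate_self hA)]
      exact Submodule.mem_span_singleton_self _
    · rw [ht.p_mul_of_not_mem hX hletters (mt (hA z).mp hz)]
      exact zero_mem _
  | zero => rw [mul_zero]; exact zero_mem _
  | add v w _ _ h1 h2 => rw [mul_add]; exact add_mem h1 h2
  | smul r v _ h => rw [mul_smul_comm]; exact Submodule.smul_mem _ r h

theorem range_p_mul_mul_p (hX : IsSubshift X) (hletters : ∀ a : 𝓐, [a] ∈ language X)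
    (hq : IsIrrational X q) {A : boolAlg X} (hA : ∀ x, Mem x A ↔ x = q) :
    Set.range (fun x : SubshiftAlgebra R X => p R X A * x * p R X A) =
      Set.range (fun r : R => r • p R X A) := by
  ext v
  constructor
  · rintro ⟨x, rfl⟩
    exact Submodule.mem_span_singleton.mp (p_mul_mul_p_mem_span hX hletters hq hA x)
  · rintro ⟨r, rfl⟩
    exact ⟨r • 1, by simp [p_mul_self]⟩

/-- Linear independence of the translates is not needed: isolating one term with nonzero coefficient
in an expansion of a nonzero element, and inverting that coefficient, recovers `p_A`. -/
theorem isAtom_span_p {K : Type*} [Field K] (hX : IsSubshift X)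
    (hletters : ∀ a : 𝓐, [a] ∈ language X)
    (hq : IsIrrational X q) {A : boolAlg X} (hA : ∀ x, Mem x A ↔ x = q) :
    IsAtom (Ideal.span {p K X A} : Ideal (SubshiftAlgebra K X)) := by
  refine ⟨?_, fun I hI => ?_⟩
  · rw [Ne, Ideal.span_singleton_eq_bot]
    exact p_ne_zero hX ((hA q).mpr rfl)
  · by_contra hbot
    obtain ⟨x, hxI, hx⟩ := Submodule.exists_mem_ne_zero_of_ne_bot hbot
    obtain ⟨u, rfl⟩ := Ideal.mem_span_singleton'.mp (hI.le hxI)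
    obtain ⟨c, hc, hsum⟩ := Submodule.mem_span_set.mp
      (mul_p_mem_span_translates (R := K) hX hletters hA u)
    obtain ⟨t, ht⟩ : c.support.Nonempty := by
      rw [Finset.nonempty_iff_ne_empty]
      intro h
      rw [Finsupp.support_eq_empty.mp h, Finsupp.sum_zero_index] at hsum
      exact hx hsum.symm
    obtain ⟨z, hz⟩ := hc ht
    obtain ⟨y, hy, hy'⟩ := exists_separating_mul hX hletters hq hA hz
    have hyx : y * (u * p K X A) = c t • p K X A := by
      rw [← hsum, Finsupp.sum, Finset.mul_sum, Finset.sum_eq_single t]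
      · rw [mul_smul_comm, hy]
      · intro t' ht' hne
        obtain ⟨z', hz'⟩ := hc ht'
        rw [mul_smul_comm, hy' z' t' hz', smul_zero]
        -- Distinct translates in the support have distinct endpoints, by uniqueness.
        rintro rfl
        exact hne (hz'.unique hX hletters hq hz)
      · exact fun h => absurd ht h
    refine hI.not_ge ((Ideal.span_singleton_le_iff_mem I).mpr ?_)
    have hmem := I.mul_mem_left ((c t)⁻¹ • y) hxI
    rwa [smul_mul_assoc, hyx, smul_smul, inv_mul_cancel₀ (Finsupp.mem_support_iff.mp ht),
      one_smul] at hmem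

end Translates

end SubshiftAlg

namespace SubshiftAlg

/-! ### The converse: minimality forces an irrational singleton -/

section Atoms

variable {R : Type*} [CommRing R] {𝓐 : Type*} {X : Set (Stream' 𝓐)}

theorem exists_mul_eq_of_isAtom {S : Type*} [Ring S] {e d : S}
    (h : IsAtom (Ideal.span {e} : Ideal S)) (hd : d ∈ Ideal.span {e}) (hd0 : d ≠ 0) :
    ∃ u, u * d = e := by
  have hle : Ideal.span {d} ≤ Ideal.span {e} := (Ideal.span_singleton_le_iff_mem _).mpr hd
  rcases h.le_iff.mp hle with h1 | h1
  · exact absurd (Ideal.span_singleton_eq_bot.mp h1) hd0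
  · exact Ideal.mem_span_singleton'.mp (h1 ▸ Ideal.mem_span_singleton_self e)

theorem exists_mem_of_p_ne_zero {A : boolAlg X} (h : p R X A ≠ 0) : ∃ x, Mem x A := by
  by_contra hA
  refine h ?_
  rw [show A = ⊥ from boolAlg_ext fun x _ =>
    ⟨fun h => absurd ⟨x, h⟩ hA, fun h => absurd h not_mem_bot⟩, p_bot]

theorem eq_of_isAtom_span_p [Nontrivial R] (hX : IsSubshift X) {A : boolAlg X}
    (h : IsAtom (Ideal.span {p R X A} : Ideal (SubshiftAlgebra R X))) {x y : Stream' 𝓐}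
    (hx : Mem x A) (hy : Mem y A) : x = y := by
  by_contra hne
  obtain ⟨n, hn⟩ : ∃ n, x.get n ≠ y.get n := by
    by_contra! hall
    exact hne (Stream'.ext hall)
  -- Length `n + 1` makes the prefix include the coordinate `n` where `x` and `y` differ.
  have hxw : x = x.take (n + 1) ++ₛ x.drop (n + 1) := (Stream'.append_take_drop _ _).symm
  have hw : x.take (n + 1) ∈ language X := mem_language_of_append_mem (hxw ▸ hx.1)
  have hnil := nil_mem_language hx.1
  set C := csetU X [] (x.take (n + 1)) hnil hw
  have hxC : Mem x C := hX.mem_range_csetU.mpr ⟨hx.1, _, hxw⟩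
  have hyC : ¬ Mem y C := by
    intro hmem
    obtain ⟨-, v, hv⟩ := hX.mem_range_csetU.mp hmem
    refine hn ?_
    have hlen : n < (x.take (n + 1)).length := by simp
    rw [hv, Stream'.get_append_left _ _ _ hlen]
    conv_lhs => rw [hxw]
    rw [Stream'.get_append_left _ _ _ hlen]
  obtain ⟨u, hu⟩ := exists_mul_eq_of_isAtom h (d := p R X (C ⊓ A))
    (Ideal.mem_span_singleton'.mpr ⟨p R X C, (p_inf R X C A).symm⟩)
    (p_ne_zero hX (mem_inf.mpr ⟨hxC, hx⟩))
  -- Right multiplication of `u p_{C ∩ A} = p_A` by the projection of `Cᶜ` annihilates the left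
  -- side, although `y` lies in `A ∩ Cᶜ`.
  refine p_ne_zero (R := R) hX (A := A ⊓ Cᶜ)
    (mem_inf.mpr ⟨hy, mem_compl.mpr ⟨hy.1, hyC⟩⟩) ?_
  rw [p_inf, ← hu, mul_assoc, ← p_inf, inf_right_comm, inf_compl_eq_bot, bot_inf_eq, p_bot,
    mul_zero]

/-- The loop fixes the point `αc` and only translates the integer coordinate. Without that
coordinate it would be indistinguishable from `p_A` at this point. -/
theorem extend_rep_periodic (hX : IsSubshift X) {α β : List 𝓐} {c : Stream' 𝓐}
    (hc : c = β ++ₛ c) {A : boolAlg X} (hA : Mem (α ++ₛ c) A) (f : X → ℤ → R) (n : ℤ) :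
    extend (rep hX (p R X A * (sWord R X α * sWord R X β * sStarWord R X α) * p R X A) f)
      (α ++ₛ c) n = extend f (α ++ₛ c) (n - β.length) := by
  have hcX : β ++ₛ c ∈ X := hc ▸ hX.mem_of_append_mem hA.1
  simp only [map_mul, Module.End.mul_apply, rep_p, rep_sWord, rep_sStarWord]
  rw [extend_opP, if_pos hA, extend_opFree_fsWord hX, if_pos hA.1]
  conv_lhs => rw [hc]
  rw [extend_opFree_fsWord hX, if_pos hcX, extend_opFree_fsStarWord hX, extend_opP, if_pos hA]
  congr 1
  ring

/-- In the representation `p_A - p_A w p_A` acts at the point as a difference operator in the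
degree: nonzero, yet killing constants. Its left multiples kill constants too, but `p_A` does not.
-/
theorem not_isAtom_span_p_of_periodic [Nontrivial R] (hX : IsSubshift X) {α β : List 𝓐}
    (hβ : β ≠ []) {A : boolAlg X} (hA : ∀ x, Mem x A ↔ x = α ++ₛ Stream'.cycle β hβ) :
    ¬ IsAtom (Ideal.span {p R X A} : Ideal (SubshiftAlgebra R X)) := by
  classical
  intro h
  have hq := (hA _).mpr rfl
  have hc := Stream'.cycle_eq β hβ
  set c := Stream'.cycle β hβ
  set w := sWord R X α * sWord R X β * sStarWord R X α with hw
  have happly : ∀ (f : X → ℤ → R) n,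
      extend (rep hX (p R X A - p R X A * w * p R X A) f) (α ++ₛ c) n =
        extend f (α ++ₛ c) n - extend f (α ++ₛ c) (n - β.length) := by
    intro f n
    rw [map_sub, LinearMap.sub_apply, extend_sub, hw, extend_rep_periodic hX hc hq, rep_p,
      extend_opP, if_pos hq]
  have hd0 : p R X A - p R X A * w * p R X A ≠ 0 := by
    intro h0
    -- A delta function in the degree detects the translation by `β.length ≠ 0`.
    have h1 := happly (fun _ n => if n = 0 then 1 else 0) 0
    rw [h0, map_zero, LinearMap.zero_apply, extend_zero, extend_of_mem hq.1,
      extend_of_mem hq.1] at h1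
    simp [hβ] at h1
  obtain ⟨u, hu⟩ := exists_mul_eq_of_isAtom h
    (Ideal.mem_span_singleton'.mpr ⟨1 - p R X A * w, by rw [sub_mul, one_mul]⟩) hd0
  have hkill : rep hX (p R X A - p R X A * w * p R X A) (1 : X → ℤ → R) = 0 := by
    refine ext_of_extend fun x n => ?_
    rw [extend_zero]
    by_cases hx : Mem x A
    · rw [(hA x).mp hx, happly, extend_of_mem hq.1, extend_of_mem hq.1]
      exact sub_self _
    · rw [mul_assoc, map_sub, LinearMap.sub_apply, extend_sub, map_mul, Module.End.mul_apply,
        rep_p, extend_opP, extend_opP, if_neg hx, if_neg hx, sub_zero]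
  have h1 : rep hX (p R X A) (1 : X → ℤ → R) = 0 := by
    rw [← hu, map_mul, Module.End.mul_apply, hkill, map_zero]
  have h2 := extend_opP A (1 : X → ℤ → R) (α ++ₛ c) 0
  rw [← rep_p hX, h1, extend_zero, if_pos hq, extend_of_mem hq.1] at h2
  exact zero_ne_one h2

theorem mem_irrationalPaths_iff {A : boolAlg X} :
    (A : Set X) ∈ irrationalPaths X ↔
      ∃ q, IsIrrational X q ∧ ∀ x, Mem x A ↔ x = q := by
  constructor
  · rintro ⟨-, ⟨q, hq⟩, hA, hirr⟩
    refine ⟨q, ⟨hq, hirr⟩, fun x => ⟨fun ⟨hx, h⟩ => ?_, fun h => ⟨h ▸ hq, ?_⟩⟩⟩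
    · rw [hA] at h
      exact congrArg Subtype.val h
    · rw [hA]
      exact Subtype.ext h
  · rintro ⟨q, ⟨hq, hirr⟩, hA⟩
    refine ⟨A.2, ⟨q, hq⟩, Set.ext fun ⟨x, hx⟩ => ⟨fun h => ?_, fun h => ?_⟩, hirr⟩
    · exact Subtype.ext ((hA x).mp ⟨hx, h⟩)
    · exact ((hA x).mpr (congrArg Subtype.val h)).2

theorem mem_irrationalPaths_of_isAtom [Nontrivial R] (hX : IsSubshift X) {A : boolAlg X}
    (h : IsAtom (Ideal.span {p R X A} : Ideal (SubshiftAlgebra R X))) :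
    (A : Set X) ∈ irrationalPaths X := by
  obtain ⟨q, hq⟩ := exists_mem_of_p_ne_zero (mt Ideal.span_singleton_eq_bot.mpr h.1)
  have hA : ∀ x, Mem x A ↔ x = q :=
    fun x => ⟨fun hx => eq_of_isAtom_span_p hX h hx hq, fun hx => hx ▸ hq⟩
  refine mem_irrationalPaths_iff.mpr ⟨q, ⟨hq.1, ?_⟩, hA⟩
  rintro α - β - hβ rfl
  exact not_isAtom_span_p_of_periodic hX hβ hA h

end Atoms

end SubshiftAlg

theorem mainTheorem4 {𝓐 : Type*} {R : Type*} [Field R]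
    (X : Set (Stream' 𝓐)) (hX : SubshiftAlg.IsSubshift X)
    (hletters : ∀ a : 𝓐, [a] ∈ SubshiftAlg.language X)
    (A : SubshiftAlg.boolAlg X) :
    (IsAtom (Ideal.span {SubshiftAlg.p R X A} : Ideal (SubshiftAlg.SubshiftAlgebra R X)) ↔
        (A : Set X) ∈ SubshiftAlg.irrationalPaths X) ∧
      ((A : Set X) ∈ SubshiftAlg.irrationalPaths X →
        Set.range (fun x : SubshiftAlg.SubshiftAlgebra R X =>
            SubshiftAlg.p R X A * x * SubshiftAlg.p R X A) =
          Set.range (fun r : R => r • SubshiftAlg.p R X A)) := by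
  refine ⟨⟨SubshiftAlg.mem_irrationalPaths_of_isAtom hX, fun h => ?_⟩, fun h => ?_⟩
  · obtain ⟨q, hq, hA⟩ := SubshiftAlg.mem_irrationalPaths_iff.mp h
    exact SubshiftAlg.isAtom_span_p hX hletters hq hA
  · obtain ⟨q, hq, hA⟩ := SubshiftAlg.mem_irrationalPaths_iff.mp h
    exact SubshiftAlg.range_p_mul_mul_p hX hletters hq hA
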